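/- Let $m\ge 1$ be an integer and let $(p_0,\dots,p_{m-1})\in(0,1)^m$. Let $X=(X_n)_{n\ge 0}$ be a time-homogeneous discrete-time Markov chain on $\mathbb{Z}$, with an arbitrary initial distribution, which from a state $i\in\mathbb{Z}$ jumps to $i+1$ with probability $p_{i \bmod m}$ and to $i-1$ with probability $1-p_{i \bmod m}$ (a cyclic birth–death chain). Put $\rho_i=(1-p_i)/p_i$ for $0\le i\le m-1$ and $\gamma=\prod_{i=0}^{m-1}\rho_i$. For $1\le r\le m$, a permutation $\sigma$ of $\{0,\dots,m-1\}$ and a vector $a=(a_0,\dots,a_{m-1})$ let $$P_r(\sigma;a)=\sum_{k=0}^{m-1}\prod_{i=0}^{r-1}a_{\sigma^{-1}(k+i)},$$ with indices interpreted modulo $m$; let $I$ denote the identity permutation and $\boldsymbol\rho_m=(\rho_0,\dots,\rho_{m-1})$. If $\gamma<1$, then almost surely the limit $v=\lim_{n\to\infty}X_n/n$ exists and $$v=\frac{1-\gamma}{1-\gamma+\frac{2}{m}\sum_{r=1}^{m}P_r(I,\boldsymbol\rho_m)}.$$ -/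

import Mathlib

/-- `X` is a discrete-time, time-homogeneous Markov chain on `ℤ` with transition probabilities
`P i j`, under the measure `μ`: given any history `X 0 = x 0, …, X n = x n` of positive
probability, the conditional probability that `X (n + 1) = j` is `P (x n) j`.
The initial law is arbitrary. -/
structure IsIntMarkovChain {Ω : Type*} [MeasurableSpace Ω] (μ : MeasureTheory.Measure Ω)
    (P : ℤ → ℤ → ℝ) (X : ℕ → Ω → ℤ) : Prop where
  measurable : ∀ n, Measurable (X n)
  cond_step : ∀ (n : ℕ) (x : ℕ → ℤ) (j : ℤ),
    μ {ω | ∀ k ≤ n, X k ω = x k} ≠ 0 →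
      (ProbabilityTheory.cond μ {ω | ∀ k ≤ n, X k ω = x k}).real {ω | X (n + 1) ω = j}
        = P (x n) j

/-- Transition probabilities of the cyclic birth-death chain with parameters
`(p 0, …, p (m - 1))`, a vector indexed by residues mod `m`: from `i`, the chain goes to `i + 1`
with probability `p (i mod m)` and to `i - 1` with probability `1 - p (i mod m)`. -/
noncomputable def cbdTransition {m : ℕ} (p : ZMod m → ℝ) (i j : ℤ) : ℝ :=
  if j = i + 1 then p (i : ZMod m) else if j = i - 1 then 1 - p (i : ZMod m) else 0

/-- `X` is a cyclic birth-death chain with parameter vector `p ∈ (0,1)^m`. -/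
structure IsCyclicBirthDeathChain {Ω : Type*} [MeasurableSpace Ω] (μ : MeasureTheory.Measure Ω)
    {m : ℕ} (p : ZMod m → ℝ) (X : ℕ → Ω → ℤ) : Prop where
  mem_Ioo : ∀ i, p i ∈ Set.Ioo (0 : ℝ) 1
  markov : IsIntMarkovChain μ (cbdTransition p) X

/-- `ρ_i = (1 - p_i) / p_i`. -/
noncomputable def cbdRho {m : ℕ} (p : ZMod m → ℝ) (i : ZMod m) : ℝ := (1 - p i) / p i

/-- `γ = ∏ ρ_i`, over the `m` residues `i` mod `m`. -/
noncomputable def cbdGamma {m : ℕ} [NeZero m] (p : ZMod m → ℝ) : ℝ := ∏ i, cbdRho p i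

/-- The cyclic product sum `P_r(σ; a) = ∑_{k=0}^{m-1} ∏_{i=0}^{r-1} a_{σ⁻¹(k+i)}`,
with indices mod `m`. -/
noncomputable def cyclicProductSum {m : ℕ} [NeZero m] (r : ℕ) (σ : Equiv.Perm (ZMod m))
    (a : ZMod m → ℝ) : ℝ :=
  ∑ k : ZMod m, ∏ i ∈ Finset.range r, a (σ⁻¹ (k + (i : ZMod m)))

/-!
The speed comes from a periodic corrector, which turns the chain into a martingale with drift.

A function `i ↦ i + φ (i mod m)` on `ℤ`, with increments `Δ i` from `i` to `i + 1`, has constant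
mean displacement `v` along the chain exactly when `p i * Δ i - (1 - p i) * Δ (i - 1) = v`, and
periodicity of `φ` means `∑ i, Δ i = m`. Writing `Δ = v (1 + 2 S)`, the first equation becomes
`S i = ρ i (1 + S (i - 1))`; its periodic solution is
`(1 - γ)⁻¹ ∑_{r=1}^m ρ_i ρ_{i-1} ⋯ ρ_{i-r+1}` (`mul_backwardProductSum`). Summing over `i` gives the
cyclic product sums (`sum_backwardProductSum`), so that the normalization `∑ i, Δ i = m` forces the
stated value of `v` (`exists_harmonic_increments`).

Hence `X n + φ (X n) - n v` is a martingale with bounded increments. Such increments are orthogonal,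
so the second moment of their `n`-th sum is `O(n)`. Divided by `n`, the sums tend to zero almost
surely along the squares, the second moments there being summable, and bounded increments
fill the gaps between squares (`ae_tendsto_sum_div_of_orthogonal`). As `φ` is bounded,
`X n / n` tends to `v`. Orthogonality is checked without conditional expectations: there are
countably many histories up to time `n`, and the defining property of the chain applies on each.
-/

open MeasureTheory Filter Topology

/-! ### Cyclic sums and products -/

@[to_additive]
theorem ZMod.prod_range_natCast {m : ℕ} [NeZero m] {M : Type*} [CommMonoid M] (f : ZMod m → M) :
    ∏ j ∈ Finset.range m, f (j : ZMod m) = ∏ i, f i :=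
  Finset.prod_nbij' (fun j : ℕ => (j : ZMod m)) ZMod.val (fun _ _ => Finset.mem_univ _)
    (fun i _ => Finset.mem_range.2 (ZMod.val_lt i))
    (fun _ hj => ZMod.val_cast_of_lt (Finset.mem_range.1 hj))
    (fun i _ => ZMod.natCast_rightInverse i) (fun _ _ => rfl)

/-- Every function on `ℤ/m` with zero sum is the discrete derivative of a function on `ℤ/m`. -/
theorem ZMod.exists_sub_eq_of_sum_eq_zero {m : ℕ} [NeZero m] (f : ZMod m → ℝ)
    (hf : ∑ i, f i = 0) : ∃ φ : ZMod m → ℝ, ∀ i, φ (i + 1) - φ i = f i := by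
  have hper : Function.Periodic (fun n : ℕ => ∑ j ∈ Finset.range n, f (j : ZMod m)) m := by
    intro n
    simp only [add_comm n m, Finset.sum_range_add, ZMod.sum_range_natCast, hf, zero_add,
      Nat.cast_add, ZMod.natCast_self]
  have hval : ∀ n : ℕ, ∑ j ∈ Finset.range (n : ZMod m).val, f (j : ZMod m)
      = ∑ j ∈ Finset.range n, f (j : ZMod m) := fun n => by
    rw [ZMod.val_natCast]
    exact hper.map_mod_nat n
  refine ⟨fun i => ∑ j ∈ Finset.range i.val, f (j : ZMod m), fun i => ?_⟩
  have h := hval (i.val + 1)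
  simp only [Nat.cast_add, ZMod.natCast_zmod_val, Nat.cast_one, Finset.sum_range_succ] at h
  simp only [h]
  ring

/-! ### The periodic harmonic coordinate -/

/-- The sum `∑_{r=1}^m a_i a_{i-1} ⋯ a_{i-r+1}` of products running backwards from `i`, with indices
mod `m`. The summation variable is `r - 1`. -/
noncomputable def backwardProductSum {m : ℕ} (a : ZMod m → ℝ) (i : ZMod m) : ℝ :=
  ∑ r ∈ Finset.range m, ∏ j ∈ Finset.range (r + 1), a (i - (j : ZMod m))

theorem sum_backwardProductSum {m : ℕ} [NeZero m] (a : ZMod m → ℝ) :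
    ∑ i, backwardProductSum a i = ∑ r ∈ Finset.Icc 1 m, cyclicProductSum r 1 a := by
  have hI : Finset.Icc 1 m = Finset.Ico (0 + 1) (m + 1) := by ext; simp
  unfold backwardProductSum cyclicProductSum
  rw [Finset.sum_comm, hI, ← Finset.sum_Ico_add', ← Finset.range_eq_Ico]
  refine Finset.sum_congr rfl fun r _ => ?_
  refine Fintype.sum_equiv (Equiv.subRight (r : ZMod m)) _ _ fun i => ?_
  -- The product running backwards from `i` runs forwards from `i - r`.
  rw [← Finset.prod_range_reflect]
  refine Finset.prod_congr rfl fun j hj => ?_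
  have hj : j ≤ r := Nat.lt_succ_iff.1 (Finset.mem_range.1 hj)
  simp only [inv_one, Equiv.Perm.coe_one, id_eq, Equiv.subRight_apply]
  rw [show r + 1 - 1 - j = r - j by omega, Nat.cast_sub hj]
  congr 1
  ring

/-- The periodic solution of the recursion `S i = a i * (1 + S (i - 1))`, multiplied through by
`1 - ∏ k, a k`: multiplication by `a i` lengthens every product by one factor, and the sum over
lengths telescopes because the product of length `m` is the full one. -/
theorem mul_backwardProductSum {m : ℕ} [NeZero m] (a : ZMod m → ℝ) (i : ZMod m) :
    a i * (1 - ∏ k, a k + backwardProductSum a (i - 1)) = backwardProductSum a i := by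
  have hs : ∀ r : ℕ, a i * ∏ j ∈ Finset.range r, a (i - 1 - (j : ZMod m))
      = ∏ j ∈ Finset.range (r + 1), a (i - (j : ZMod m)) := fun r => by
    rw [Finset.prod_range_succ', mul_comm]
    simp [sub_sub, add_comm]
  have hfull : ∏ j ∈ Finset.range m, a (i - 1 - (j : ZMod m)) = ∏ k, a k := by
    rw [ZMod.prod_range_natCast (fun k => a (i - 1 - k))]
    exact Fintype.prod_equiv (Equiv.subLeft (i - 1)) _ _ fun _ => rfl
  have htel := Finset.sum_range_sub
    (fun r => ∏ j ∈ Finset.range (r + 1), a (i - (j : ZMod m))) m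
  rw [Finset.sum_sub_distrib, ← hs m, hfull] at htel
  have h1 : a i * backwardProductSum a (i - 1)
      = ∑ r ∈ Finset.range m, ∏ j ∈ Finset.range (r + 1 + 1), a (i - (j : ZMod m)) := by
    simp only [backwardProductSum, Finset.mul_sum, hs]
  rw [mul_add, h1]
  simp only [backwardProductSum]
  simp only [zero_add, Finset.prod_range_one, Nat.cast_zero, sub_zero] at htel
  linarith

/-- The increments `Δ` of a coordinate on `ℤ`, at bounded distance from the identity, along which the
chain has constant drift `v`. -/
theorem exists_harmonic_increments {m : ℕ} [NeZero m] (p : ZMod m → ℝ)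
    (hp : ∀ i, p i ∈ Set.Ioo (0 : ℝ) 1) (hγ : cbdGamma p < 1) {v : ℝ}
    (hv : v = (1 - cbdGamma p) / (1 - cbdGamma p +
      2 / (m : ℝ) * ∑ r ∈ Finset.Icc 1 m, cyclicProductSum r 1 (cbdRho p))) :
    ∃ Δ : ZMod m → ℝ, (∀ i, p i * Δ i - (1 - p i) * Δ (i - 1) = v) ∧ ∑ i, Δ i = m := by
  have hρ : ∀ i, 0 < cbdRho p i := fun i => div_pos (sub_pos.2 (hp i).2) (hp i).1
  have hm : (0 : ℝ) < m := Nat.cast_pos.2 (NeZero.pos m)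
  have hP : 0 ≤ ∑ r ∈ Finset.Icc 1 m, cyclicProductSum r 1 (cbdRho p) :=
    Finset.sum_nonneg fun r _ => Finset.sum_nonneg fun k _ =>
      Finset.prod_nonneg fun i _ => (hρ _).le
  have h1 : 0 < 1 - cbdGamma p := sub_pos.2 hγ
  refine ⟨fun i => v * (1 + 2 * (backwardProductSum (cbdRho p) i / (1 - cbdGamma p))),
    fun i => ?_, ?_⟩
  · have h := mul_backwardProductSum (cbdRho p) i
    change cbdRho p i * (1 - cbdGamma p + _) = _ at h
    have hpi : p i * cbdRho p i = 1 - p i := mul_div_cancel₀ _ (hp i).1.ne'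
    have hS : p i * (backwardProductSum (cbdRho p) i / (1 - cbdGamma p))
        = (1 - p i) * (1 + backwardProductSum (cbdRho p) (i - 1) / (1 - cbdGamma p)) := by
      rw [← h, ← hpi]
      field_simp
    linear_combination 2 * v * hS
  · rw [← Finset.mul_sum, Finset.sum_add_distrib, ← Finset.mul_sum, ← Finset.sum_div,
      sum_backwardProductSum, hv]
    have hden : 0 < 1 - cbdGamma p +
      2 / (m : ℝ) * ∑ r ∈ Finset.Icc 1 m, cyclicProductSum r 1 (cbdRho p) := by positivity
    rw [div_mul_eq_mul_div, div_eq_iff hden.ne']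
    simp [ZMod.card]
    field_simp

/-! ### A strong law for bounded orthogonal increments -/

/-- With increments bounded by `C`, a sequence moves by at most `2 k C` between `k ^ 2` and
`(k + 1) ^ 2`, which is negligible against `k ^ 2`. -/
theorem tendsto_div_of_sq_subsequence {S : ℕ → ℝ} {C : ℝ} (hC : 0 ≤ C)
    (hS : ∀ n, |S (n + 1) - S n| ≤ C)
    (hsub : Tendsto (fun k : ℕ => S (k ^ 2) / (k : ℝ) ^ 2) atTop (𝓝 0)) :
    Tendsto (fun n : ℕ => S n / n) atTop (𝓝 0) := by
  have hgap : ∀ n d, |S (n + d) - S n| ≤ d * C := fun n d => by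
    induction d with
    | zero => simp
    | succ d ih =>
      have := abs_sub_le (S (n + d + 1)) (S (n + d)) (S n)
      have := hS (n + d)
      rw [← add_assoc]
      push_cast
      linarith
  have hsqrt : Tendsto Nat.sqrt atTop atTop :=
    tendsto_atTop.2 fun b => (eventually_ge_atTop (b * b)).mono fun n hn => Nat.le_sqrt.2 hn
  have hb : Tendsto (fun k : ℕ => |S (k ^ 2) / (k : ℝ) ^ 2| + 2 * C / k) atTop (𝓝 0) := by
    simpa using hsub.abs.add (tendsto_const_div_atTop_nhds_zero_nat (2 * C))
  refine squeeze_zero_norm (fun n => ?_) (hb.comp hsqrt)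
  rcases Nat.eq_zero_or_pos n with rfl | hn
  · simp
  have hk : 0 < Nat.sqrt n := Nat.sqrt_pos.2 hn
  simp only [Function.comp, Real.norm_eq_abs]
  generalize hkk : Nat.sqrt n = k at hk
  have hle : k ^ 2 ≤ n := by rw [← hkk, sq]; exact Nat.sqrt_le n
  have hle2 : n ≤ k ^ 2 + 2 * k := by
    have := Nat.sqrt_le_add n
    rw [hkk] at this
    nlinarith
  obtain ⟨d, rfl⟩ := Nat.exists_eq_add_of_le hle
  have hd : (d : ℝ) ≤ 2 * k := by exact_mod_cast (by omega : d ≤ 2 * k)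
  have hk' : (0 : ℝ) < k := by exact_mod_cast hk
  have hnum : |S (k ^ 2 + d)| ≤ |S (k ^ 2)| + 2 * k * C := by
    have h1 := hgap (k ^ 2) d
    have h2 := abs_sub_abs_le_abs_sub (S (k ^ 2 + d)) (S (k ^ 2))
    have h3 := mul_le_mul_of_nonneg_right hd hC
    linarith
  calc |S (k ^ 2 + d) / ((k ^ 2 + d : ℕ) : ℝ)|
      = |S (k ^ 2 + d)| / ((k ^ 2 + d : ℕ) : ℝ) := by rw [abs_div, Nat.abs_cast]
    _ ≤ (|S (k ^ 2)| + 2 * k * C) / (k : ℝ) ^ 2 := by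
        gcongr
        push_cast
        linarith [Nat.cast_nonneg (α := ℝ) d]
    _ = |S (k ^ 2) / (k : ℝ) ^ 2| + 2 * C / k := by
        rw [abs_div, abs_of_pos (by positivity : (0 : ℝ) < (k : ℝ) ^ 2)]
        field_simp

theorem ae_tendsto_zero_of_summable_integral_sq {Ω : Type*} [MeasurableSpace Ω] {μ : Measure Ω}
    {f : ℕ → Ω → ℝ} (hf : ∀ k, Integrable (fun ω => f k ω ^ 2) μ) {b : ℕ → ℝ}
    (hb : Summable b) (hfb : ∀ k, ∫ ω, f k ω ^ 2 ∂μ ≤ b k) :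
    ∀ᵐ ω ∂μ, Tendsto (fun k => f k ω) atTop (𝓝 0) := by
  have hmeas : ∀ k, AEMeasurable (fun ω => ENNReal.ofReal (f k ω ^ 2)) μ :=
    fun k => (hf k).aemeasurable.ennreal_ofReal
  have hfin : ∫⁻ ω, ∑' k, ENNReal.ofReal (f k ω ^ 2) ∂μ ≠ ⊤ := by
    rw [lintegral_tsum hmeas]
    refine ne_top_of_le_ne_top hb.tsum_ofReal_ne_top (ENNReal.tsum_le_tsum fun k => ?_)
    rw [← ofReal_integral_eq_lintegral_ofReal (hf k) (ae_of_all _ fun ω => sq_nonneg _)]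
    exact ENNReal.ofReal_le_ofReal (hfb k)
  filter_upwards [ae_lt_top' (AEMeasurable.tsum hmeas) hfin] with ω hω
  have h := ENNReal.tendsto_atTop_zero_of_tsum_ne_top hω.ne
  have h2 : Tendsto (fun k => f k ω ^ 2) atTop (𝓝 0) := by
    have := (ENNReal.tendsto_toReal ENNReal.zero_ne_top).comp h
    simpa [Function.comp_def, ENNReal.toReal_ofReal (sq_nonneg _)] using this
  have h3 := h2.sqrt
  simp only [Real.sqrt_sq_eq_abs, Real.sqrt_zero] at h3
  exact (tendsto_zero_iff_abs_tendsto_zero _).2 h3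

/-- A strong law of large numbers: the hypothesis `horth` asks only that each increment be orthogonal
to the sum of the earlier ones. -/
theorem ae_tendsto_sum_div_of_orthogonal {Ω : Type*} [MeasurableSpace Ω] {μ : Measure Ω}
    [IsProbabilityMeasure μ] {D : ℕ → Ω → ℝ} (hD : ∀ n, Measurable (D n)) {C : ℝ}
    (hC : ∀ n ω, |D n ω| ≤ C)
    (horth : ∀ n, ∫ ω, (∑ k ∈ Finset.range n, D k ω) * D n ω ∂μ = 0) :
    ∀ᵐ ω ∂μ, Tendsto (fun n : ℕ => (∑ k ∈ Finset.range n, D k ω) / n) atTop (𝓝 0) := by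
  obtain ⟨ω₀⟩ : Nonempty Ω := nonempty_of_isProbabilityMeasure μ
  have hC0 : 0 ≤ C := (abs_nonneg _).trans (hC 0 ω₀)
  have hSm : ∀ n, Measurable fun ω => ∑ k ∈ Finset.range n, D k ω :=
    fun n => Finset.measurable_sum _ fun k _ => hD k
  have hSb : ∀ n ω, |∑ k ∈ Finset.range n, D k ω| ≤ n * C := fun n ω => by
    refine (Finset.abs_sum_le_sum_abs _ _).trans ?_
    simpa using Finset.sum_le_sum (s := Finset.range n) fun k _ => hC k ω
  have hint : ∀ {f : Ω → ℝ} (K : ℝ), Measurable f → (∀ ω, |f ω| ≤ K) → Integrable f μ :=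
    fun K hf hK => Integrable.of_bound hf.aestronglyMeasurable K (ae_of_all _ hK)
  have hS2 : ∀ n, Integrable (fun ω => (∑ k ∈ Finset.range n, D k ω) ^ 2) μ := fun n =>
    hint ((n * C) ^ 2) ((hSm n).pow_const 2) fun ω => by
      rw [abs_pow]; exact pow_le_pow_left₀ (abs_nonneg _) (hSb n ω) 2
  have hSD : ∀ n, Integrable (fun ω => (∑ k ∈ Finset.range n, D k ω) * D n ω) μ := fun n =>
    hint (n * C * C) ((hSm n).mul (hD n)) fun ω => by
      rw [abs_mul]
      exact mul_le_mul (hSb n ω) (hC n ω) (abs_nonneg _) (by positivity)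
  have hDsq : ∀ n ω, D n ω ^ 2 ≤ C ^ 2 := fun n ω =>
    sq_le_sq' (abs_le.1 (hC n ω)).1 (abs_le.1 (hC n ω)).2
  have hD2 : ∀ n, Integrable (fun ω => D n ω ^ 2) μ := fun n =>
    hint (C ^ 2) ((hD n).pow_const 2) fun ω => by
      rw [abs_of_nonneg (sq_nonneg _)]; exact hDsq n ω
  have hvar : ∀ n : ℕ, ∫ ω, (∑ k ∈ Finset.range n, D k ω) ^ 2 ∂μ ≤ n * C ^ 2 := fun n => by
    induction n with
    | zero => simp
    | succ n ih =>
      have hexp : ∀ ω, (∑ k ∈ Finset.range (n + 1), D k ω) ^ 2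
          = (∑ k ∈ Finset.range n, D k ω) ^ 2
            + 2 * ((∑ k ∈ Finset.range n, D k ω) * D n ω) + D n ω ^ 2 := fun ω => by
        rw [Finset.sum_range_succ]; ring
      have hadd : ∫ ω, (∑ k ∈ Finset.range (n + 1), D k ω) ^ 2 ∂μ
          = ∫ ω, (∑ k ∈ Finset.range n, D k ω) ^ 2 ∂μ + ∫ ω, D n ω ^ 2 ∂μ := by
        simp_rw [hexp]
        refine (integral_add ((hS2 n).add ((hSD n).const_mul 2)) (hD2 n)).trans ?_
        congr 1
        refine (integral_add (hS2 n) ((hSD n).const_mul 2)).trans ?_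
        rw [integral_const_mul, horth n, mul_zero, add_zero]
      rw [hadd]
      have : ∫ ω, D n ω ^ 2 ∂μ ≤ C ^ 2 := by
        simpa using integral_mono (hD2 n) (integrable_const (C ^ 2)) (hDsq n)
      push_cast
      linarith
  have hae := ae_tendsto_zero_of_summable_integral_sq (μ := μ)
    (f := fun k ω => (∑ j ∈ Finset.range (k ^ 2), D j ω) / (k : ℝ) ^ 2)
    (b := fun k : ℕ => C ^ 2 * (1 / (k : ℝ) ^ 2))
    (fun k => by simpa only [div_pow] using (hS2 (k ^ 2)).div_const _)
    ((Real.summable_one_div_nat_pow.2 one_lt_two).mul_left _) fun k => by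
      simp only [div_pow, integral_div]
      rcases Nat.eq_zero_or_pos k with rfl | hk
      · simp
      have hk' : (0 : ℝ) < k := by exact_mod_cast hk
      rw [div_le_iff₀ (by positivity)]
      refine (hvar (k ^ 2)).trans (le_of_eq ?_)
      push_cast
      field_simp
  filter_upwards [hae] with ω hω
  refine tendsto_div_of_sq_subsequence hC0 (fun n => ?_) hω
  rw [Finset.sum_range_succ, add_sub_cancel_left]
  exact hC n ω

/-! ### Conditioning on histories -/

theorem measurableSet_history {Ω : Type*} [MeasurableSpace Ω] {X : ℕ → Ω → ℤ}
    (hX : ∀ n, Measurable (X n)) (n : ℕ) (x : ℕ → ℤ) :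
    MeasurableSet {ω | ∀ k ≤ n, X k ω = x k} := by
  simp only [Set.ofPred_forall]
  exact MeasurableSet.iInter fun k => MeasurableSet.iInter fun _ =>
    hX k (measurableSet_singleton (x k))

theorem preimage_history {Ω : Type*} (X : ℕ → Ω → ℤ) (n : ℕ) (ω₀ : Ω) :
    (fun ω (k : Fin (n + 1)) => X k ω) ⁻¹' {fun k : Fin (n + 1) => X k ω₀}
      = {ω | ∀ k ≤ n, X k ω = X k ω₀} := by
  ext ω
  simp only [Set.mem_preimage, Set.mem_singleton_iff, Set.mem_ofPred_eq, funext_iff]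
  exact ⟨fun h k hk => h ⟨k, Nat.lt_succ_of_le hk⟩, fun h k => h k (Nat.lt_succ_iff.1 k.2)⟩

/-- The histories up to time `n` split the space into countably many events, and it suffices to
integrate over each nonempty one, given by the history of some point `ω₀`. -/
theorem integral_eq_zero_of_forall_history {Ω : Type*} [MeasurableSpace Ω] {μ : Measure Ω}
    {X : ℕ → Ω → ℤ} (hX : ∀ n, Measurable (X n)) (n : ℕ) {f : Ω → ℝ} (hf : Integrable f μ)
    (h : ∀ ω₀, ∫ ω in {ω | ∀ k ≤ n, X k ω = X k ω₀}, f ω ∂μ = 0) : ∫ ω, f ω ∂μ = 0 := by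
  let H : Ω → Fin (n + 1) → ℤ := fun ω k => X k ω
  have hH : Measurable H := measurable_pi_lambda _ fun k => hX k
  have hU : ⋃ h, H ⁻¹' {h} = Set.univ := by
    rw [← Set.preimage_iUnion, Set.iUnion_of_singleton, Set.preimage_univ]
  rw [← setIntegral_univ, ← hU, integral_iUnion (fun h => hH (measurableSet_singleton h))
    (pairwise_disjoint_fiber H) hf.integrableOn]
  refine (tsum_congr fun x => ?_).trans tsum_zero
  rcases (H ⁻¹' {x}).eq_empty_or_nonempty with he | ⟨ω₀, rfl⟩
  · rw [he, setIntegral_empty]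
  · rw [show H ⁻¹' {H ω₀} = _ from preimage_history X n ω₀]
    exact h ω₀

theorem ae_of_forall_history {Ω : Type*} [MeasurableSpace Ω] {μ : Measure Ω}
    (X : ℕ → Ω → ℤ) (n : ℕ) {q : Ω → Prop}
    (h : ∀ ω₀, μ ({ω | ∀ k ≤ n, X k ω = X k ω₀} ∩ {ω | ¬ q ω}) = 0) : ∀ᵐ ω ∂μ, q ω := by
  let H : Ω → Fin (n + 1) → ℤ := fun ω k => X k ω
  refine measure_mono_null (t := ⋃ x, H ⁻¹' {x} ∩ {ω | ¬ q ω})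
    (fun ω hω => Set.mem_iUnion.2 ⟨H ω, rfl, hω⟩) (measure_iUnion_null fun x => ?_)
  rcases (H ⁻¹' {x}).eq_empty_or_nonempty with he | ⟨ω₀, rfl⟩
  · rw [he, Set.empty_inter, measure_empty]
  · rw [show H ⁻¹' {H ω₀} = _ from preimage_history X n ω₀]
    exact h ω₀

namespace IsIntMarkovChain

/-- The Markov property in product form, which also covers histories of probability zero. -/
theorem measureReal_history_inter {Ω : Type*} [MeasurableSpace Ω] {μ : Measure Ω}
    [IsFiniteMeasure μ] {P : ℤ → ℤ → ℝ} {X : ℕ → Ω → ℤ} (hX : IsIntMarkovChain μ P X) (n : ℕ)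
    (x : ℕ → ℤ) (j : ℤ) :
    μ.real ({ω | ∀ k ≤ n, X k ω = x k} ∩ {ω | X (n + 1) ω = j})
      = μ.real {ω | ∀ k ≤ n, X k ω = x k} * P (x n) j := by
  by_cases h0 : μ {ω | ∀ k ≤ n, X k ω = x k} = 0
  · simp [measureReal_def, h0, measure_mono_null Set.inter_subset_left h0]
  · have h := hX.cond_step n x j h0
    have hne : μ.real {ω | ∀ k ≤ n, X k ω = x k} ≠ 0 :=
      (measureReal_ne_zero_iff (measure_ne_top _ _)).2 h0
    rw [← h, measureReal_def (ProbabilityTheory.cond _ _),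
      ProbabilityTheory.cond_apply (measurableSet_history hX.measurable n x), ENNReal.toReal_mul,
      ENNReal.toReal_inv, ← measureReal_def, ← measureReal_def,
      mul_inv_cancel_left₀ hne]

end IsIntMarkovChain

/-! ### The martingale of the cyclic birth-death chain -/

/-- The displacement, minus `v`, of a coordinate with increments `Δ` when the chain steps from `x` to
`y`. Every `y ≠ x + 1` counts as a step to `x - 1`, so that the displacement is bounded everywhere
and not only almost surely. -/
noncomputable def compensatedStep {m : ℕ} (Δ : ZMod m → ℝ) (v : ℝ) (x y : ℤ) : ℝ :=
  if y = x + 1 then Δ (x : ZMod m) - v else -Δ ((x : ZMod m) - 1) - v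

namespace IsCyclicBirthDeathChain

variable {Ω : Type*} [MeasurableSpace Ω] {μ : Measure Ω} [IsProbabilityMeasure μ] {m : ℕ}
  {p : ZMod m → ℝ} {X : ℕ → Ω → ℤ}

theorem ae_step (hX : IsCyclicBirthDeathChain μ p X) (n : ℕ) :
    ∀ᵐ ω ∂μ, X (n + 1) ω = X n ω + 1 ∨ X (n + 1) ω = X n ω - 1 := by
  refine ae_of_forall_history X n fun ω₀ => ?_
  refine measure_mono_null (t := ⋃ j : {j : ℤ // j ≠ X n ω₀ + 1 ∧ j ≠ X n ω₀ - 1},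
    {ω | ∀ k ≤ n, X k ω = X k ω₀} ∩ {ω | X (n + 1) ω = j}) ?_ (measure_iUnion_null ?_)
  · rintro ω ⟨hω, hq⟩
    simp only [Set.mem_ofPred_eq, not_or, hω n le_rfl] at hq
    exact Set.mem_iUnion.2 ⟨⟨X (n + 1) ω, hq⟩, hω, rfl⟩
  · rintro ⟨j, hj⟩
    have h := hX.markov.measureReal_history_inter n (fun k => X k ω₀) j
    rw [cbdTransition, if_neg hj.1, if_neg hj.2, mul_zero] at h
    exact (measureReal_eq_zero_iff (measure_ne_top _ _)).1 h

theorem setIntegral_history_ite (hX : IsCyclicBirthDeathChain μ p X) (n : ℕ) (ω₀ : Ω)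
    (a b : ℝ) :
    ∫ ω in {ω | ∀ k ≤ n, X k ω = X k ω₀}, (if X (n + 1) ω = X n ω₀ + 1 then a else b) ∂μ
      = μ.real {ω | ∀ k ≤ n, X k ω = X k ω₀}
        * (p (X n ω₀ : ZMod m) * a + (1 - p (X n ω₀ : ZMod m)) * b) := by
  have hB : MeasurableSet {ω | X (n + 1) ω = X n ω₀ + 1} :=
    hX.markov.measurable (n + 1) (measurableSet_singleton _)
  have hA := measurableSet_history hX.markov.measurable n (fun k => X k ω₀)
  have h := hX.markov.measureReal_history_inter n (fun k => X k ω₀) (X n ω₀ + 1)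
  rw [cbdTransition, if_pos rfl] at h
  have hind : ∀ ω, (if X (n + 1) ω = X n ω₀ + 1 then a else b)
      = {ω | X (n + 1) ω = X n ω₀ + 1}.indicator (fun _ => a - b) ω + b := fun ω => by
    by_cases hω : X (n + 1) ω = X n ω₀ + 1 <;> simp [hω]
  simp_rw [hind]
  rw [integral_add ((integrable_const _).indicator hB) (integrable_const _),
    integral_indicator hB, Measure.restrict_restrict hB, setIntegral_const, setIntegral_const,
    Set.inter_comm, h]
  simp only [smul_eq_mul]
  ring

theorem ae_tendsto_sum_compensated_div [NeZero m] (hX : IsCyclicBirthDeathChain μ p X)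
    {Δ : ZMod m → ℝ} {v : ℝ} (hΔ : ∀ i, p i * Δ i - (1 - p i) * Δ (i - 1) = v) :
    ∀ᵐ ω ∂μ, Tendsto (fun n : ℕ => (∑ k ∈ Finset.range n,
      compensatedStep Δ v (X k ω) (X (k + 1) ω)) / n) atTop (𝓝 0) := by
  have hm : ∀ n, Measurable fun ω => compensatedStep Δ v (X n ω) (X (n + 1) ω) := fun n =>
    (Measurable.of_discrete (f := fun z : ℤ × ℤ => compensatedStep Δ v z.1 z.2)).comp
      ((hX.markov.measurable n).prodMk (hX.markov.measurable (n + 1)))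
  obtain ⟨K, hK⟩ : ∃ K, ∀ i, |Δ i| ≤ K :=
    ⟨∑ i, |Δ i|, fun i => Finset.single_le_sum (f := fun i => |Δ i|)
      (fun i _ => abs_nonneg _) (Finset.mem_univ i)⟩
  have hb : ∀ n ω, |compensatedStep Δ v (X n ω) (X (n + 1) ω)| ≤ K + |v| := fun n ω => by
    unfold compensatedStep
    split_ifs
    · exact (abs_sub _ _).trans (add_le_add_left (hK _) _)
    · exact (abs_sub _ _).trans (add_le_add_left ((abs_neg _).trans_le (hK _)) _)
  refine ae_tendsto_sum_div_of_orthogonal hm hb fun n => ?_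
  refine integral_eq_zero_of_forall_history hX.markov.measurable n ?_ fun ω₀ => ?_
  · refine Integrable.of_bound ((Finset.measurable_sum _ fun k _ => hm k).mul
      (hm n)).aestronglyMeasurable (n * (K + |v|) * (K + |v|)) (ae_of_all _ fun ω => ?_)
    rw [Real.norm_eq_abs, abs_mul]
    have h1 : ∀ k ∈ Finset.range n, |compensatedStep Δ v (X k ω) (X (k + 1) ω)| ≤ K + |v| :=
      fun k _ => hb k ω
    have h2 := (Finset.abs_sum_le_sum_abs _ _).trans (Finset.sum_le_sum h1)
    rw [Finset.sum_const, Finset.card_range, nsmul_eq_mul] at h2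
    exact mul_le_mul h2 (hb n ω) (abs_nonneg _) ((abs_nonneg _).trans h2)
  · -- The past sum is constant on the event of a given history, so only the last step varies there.
    have hA := measurableSet_history hX.markov.measurable n (fun k => X k ω₀)
    have hcongr : Set.EqOn
        (fun ω => (∑ k ∈ Finset.range n, compensatedStep Δ v (X k ω) (X (k + 1) ω)) *
          compensatedStep Δ v (X n ω) (X (n + 1) ω))
        (fun ω => (∑ k ∈ Finset.range n, compensatedStep Δ v (X k ω₀) (X (k + 1) ω₀)) *
          compensatedStep Δ v (X n ω₀) (X (n + 1) ω))
        {ω | ∀ k ≤ n, X k ω = X k ω₀} := fun ω hω => by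
      have hs : ∀ k ≤ n, X k ω = X k ω₀ := hω
      simp only [hs n le_rfl]
      congr 1
      refine Finset.sum_congr rfl fun k hk => ?_
      rw [hs k (Finset.mem_range.1 hk).le, hs (k + 1) (Finset.mem_range.1 hk)]
    rw [setIntegral_congr_fun hA hcongr, integral_const_mul]
    simp only [compensatedStep]
    rw [hX.setIntegral_history_ite n ω₀]
    have := hΔ (X n ω₀ : ZMod m)
    rw [show p (X n ω₀ : ZMod m) * (Δ (X n ω₀ : ZMod m) - v) + (1 - p (X n ω₀ : ZMod m))
      * (-Δ ((X n ω₀ : ZMod m) - 1) - v) = 0 by linear_combination this]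
    simp

end IsCyclicBirthDeathChain


/-- The almost sure speed of a cyclic birth-death chain with `γ < 1`. -/
theorem proposition1p5 {m : ℕ} [NeZero m] {Ω : Type*} [MeasurableSpace Ω]
    (μ : MeasureTheory.Measure Ω) [MeasureTheory.IsProbabilityMeasure μ]
    (p : ZMod m → ℝ) (X : ℕ → Ω → ℤ) (hX : IsCyclicBirthDeathChain μ p X)
    (hγ : cbdGamma p < 1) :
    ∀ᵐ ω ∂μ, Filter.Tendsto (fun n : ℕ => (X n ω : ℝ) / (n : ℝ)) Filter.atTop
      (nhds ((1 - cbdGamma p) /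
        (1 - cbdGamma p +
          2 / (m : ℝ) * ∑ r ∈ Finset.Icc 1 m, cyclicProductSum r 1 (cbdRho p)))) := by
  obtain ⟨v, hv⟩ : ∃ v, v = (1 - cbdGamma p) / (1 - cbdGamma p +
    2 / (m : ℝ) * ∑ r ∈ Finset.Icc 1 m, cyclicProductSum r 1 (cbdRho p)) := ⟨_, rfl⟩
  rw [← hv]
  obtain ⟨Δ, hΔ, hsum⟩ := exists_harmonic_increments p hX.mem_Ioo hγ hv
  obtain ⟨φ, hφ⟩ := ZMod.exists_sub_eq_of_sum_eq_zero (fun i => Δ i - 1) (by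
    rw [Finset.sum_sub_distrib, hsum]
    simp [ZMod.card])
  filter_upwards [hX.ae_tendsto_sum_compensated_div hΔ, ae_all_iff.2 hX.ae_step] with ω hM hstep
  -- The compensated sum telescopes, because it adds up the increments of the harmonic coordinate
  -- `i + φ i`, minus `v` per step.
  have hrep : ∀ n : ℕ, ∑ k ∈ Finset.range n, compensatedStep Δ v (X k ω) (X (k + 1) ω)
      = (X n ω + φ (X n ω : ZMod m)) - (X 0 ω + φ (X 0 ω : ZMod m)) - n * v := fun n => by
    induction n with
    | zero => simp
    | succ n ih =>
      rw [Finset.sum_range_succ, ih, compensatedStep]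
      rcases hstep n with h | h
      · rw [if_pos h, h]
        push_cast
        linear_combination -hφ (X n ω : ZMod m)
      · rw [if_neg (by omega), h]
        have := hφ ((X n ω : ZMod m) - 1)
        rw [sub_add_cancel] at this
        push_cast
        linear_combination this
  obtain ⟨K, hK⟩ : ∃ K, ∀ i, |φ i| ≤ K :=
    ⟨∑ i, |φ i|, fun i => Finset.single_le_sum (f := fun i => |φ i|)
      (fun i _ => abs_nonneg _) (Finset.mem_univ i)⟩
  have hφ0 : Tendsto (fun n : ℕ => φ (X n ω : ZMod m) / n) atTop (𝓝 0) :=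
    squeeze_zero_norm (fun n => by
      rw [Real.norm_eq_abs, abs_div, Nat.abs_cast]
      exact div_le_div_of_nonneg_right (hK _) (Nat.cast_nonneg n))
      (tendsto_const_div_atTop_nhds_zero_nat K)
  have hlim := ((hM.sub hφ0).add
    (tendsto_const_div_atTop_nhds_zero_nat (X 0 ω + φ (X 0 ω : ZMod m)))).add_const v
  rw [sub_zero, zero_add, zero_add] at hlim
  refine hlim.congr' ((eventually_gt_atTop 0).mono fun n hn => ?_)
  have hn' : (n : ℝ) ≠ 0 := by exact_mod_cast hn.ne'
  rw [hrep n]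
  field_simp
  ring
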